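/- Let $\Bbbk$ be a field of characteristic $0$. A matrix $\mathbf p=(p_{ij})\in M_n(\Bbbk)$ is multiplicatively antisymmetric if $p_{ii}=1$ and $p_{ij}p_{ji}=1$ for all $i,j$; then $\Bbbk_{\mathbf p}[x_1,\dots,x_n]$ denotes the $\Bbbk$-algebra generated by $x_1,\dots,x_n$ subject to the relations $x_jx_i=p_{ij}x_ix_j$ for all $1\le i,j\le n$. If an algebra $S$ is presented as $S=\Bbbk_{\mathbf p}[x_1,\dots,x_n]$, let $Z(S)$ be its center and put $$\mathfrak f_i=\gcd\{d_i \mid (d_1,\dots,d_n)\in\mathbb Z_{\ge0}^n,\ x_1^{d_1}\cdots x_n^{d_n}\in Z(S)\}\qquad(1\le i\le n).$$ Define the ozone Jacobian, ozone arrangement and ozone discriminant of $S$ with respect to $x_1,\dots,x_n$ by $$\mathfrak{oj}_S=\prod_{i=1}^n x_i^{\mathfrak f_i-1},\qquad \mathfrak{oa}_S=\prod_{\mathfrak f_i>1}x_i,\qquad \mathfrak{od}_S=\prod_{\mathfrak f_i>1}x_i^{\mathfrak f_i},$$ the products being taken in increasing order of the indices. **Proposition 1.8.** Let $S=\Bbbk_{\mathbf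 p}[x_1,\dots,x_n]$ with $\mathbf p$ multiplicatively antisymmetric, all $p_{ij}$ roots of unity, and not all $p_{ij}$ equal to $1$. Let $T=\Bbbk_{\mathbf q}[y_1,\dots,y_m]$ with $\mathbf q\in M_m(\Bbbk)$ multiplicatively antisymmetric, and let $\varphi:S\to T$ be any isomorphism of $\Bbbk$-algebras (for example, $T=S$ with another choice of generators and $\varphi=\mathrm{id}$). Let $\mathfrak f_i$, $\mathfrak{oj}_S,\mathfrak{oa}_S,\mathfrak{od}_S$ be formed with respect to $x_1,\dots,x_n$, and let $\mathfrak f'_j$, $\mathfrak{oj}_T,\mathfrak{oa}_T,\mathfrak{od}_T$ be the corresponding integers and elements formed with respect to $y_1,\dots,y_m$. Then: 1. there are $c_1,c_2,c_3\in\Bbbk^\times$ with $\varphi(\mathfrak{oj}_S)=c_1\,\mathfrak{oj}_T$, $\varphi(\mathfrak{oa}_S)=c_2\,\mathfrak{oa}_T$ and $\varphi(\mathfrak{od}_S)=c_3\,\mathfrak{od}_T$; 2. the multisets $\{\mathfrak f_1,\dots,\mathfrak f_n\}$ and $\{\mathfrak f'_1,\dots,\mathfrak f'_m\}$ are equal.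 -/

import Mathlib

namespace OzoneSkew

/-- A matrix `p` is multiplicatively antisymmetric if `p i i = 1` and `p i j * p j i = 1`. -/
structure IsMulAntisymm {k : Type*} [Field k] {n : ℕ} (p : Matrix (Fin n) (Fin n) k) : Prop where
  diag : ∀ i, p i i = 1
  mul_swap : ∀ i j, p i j * p j i = 1

/-- The defining relations `x_j x_i = p_ij x_i x_j` of a skew polynomial ring. -/
inductive SkewRel {k : Type*} [Field k] {n : ℕ} (p : Matrix (Fin n) (Fin n) k) :
    FreeAlgebra k (Fin n) → FreeAlgebra k (Fin n) → Prop
  | comm (i j : Fin n) : SkewRel p (FreeAlgebra.ι k j * FreeAlgebra.ι k i)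
      (p i j • (FreeAlgebra.ι k i * FreeAlgebra.ι k j))

/-- The skew polynomial ring `k_p[x_1, …, x_n]`: the `k`-algebra generated by `x_1, …, x_n`
subject to the relations `x_j x_i = p_ij x_i x_j`. -/
abbrev SkewPoly {k : Type*} [Field k] {n : ℕ} (p : Matrix (Fin n) (Fin n) k) : Type _ :=
  RingQuot (SkewRel p)

/-- The standard generator `x_i` of the skew polynomial ring. -/
noncomputable def SkewPoly.gen {k : Type*} [Field k] {n : ℕ} (p : Matrix (Fin n) (Fin n) k)
    (i : Fin n) : SkewPoly p :=
  RingQuot.mkAlgHom k (SkewRel p) (FreeAlgebra.ι k i)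

/-- The family `x` of elements of `S` presents `S` as the skew polynomial ring
`k_p[x_1, …, x_n]`. -/
def IsSkewGenerators {k : Type*} [Field k] {S : Type*} [Ring S] [Algebra k S] {n : ℕ}
    (p : Matrix (Fin n) (Fin n) k) (x : Fin n → S) : Prop :=
  ∃ e : SkewPoly p ≃ₐ[k] S, ∀ i, e (SkewPoly.gen p i) = x i

/-- The ordered monomial `x_1 ^ d_1 * ⋯ * x_n ^ d_n`. -/
def orderedMonomial {S : Type*} [Ring S] {n : ℕ} (x : Fin n → S) (d : Fin n → ℕ) : S :=
  (List.ofFn fun i => x i ^ d i).prod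

/-- `f_i`: the greatest common divisor of all `d_i` that occur as the `i`-th exponent of a
monomial `x_1 ^ d_1 * ⋯ * x_n ^ d_n` in the center of `S`. -/
noncomputable def ozoneExponent {S : Type*} [Ring S] {n : ℕ} (x : Fin n → S) (i : Fin n) : ℕ :=
  Nat.setGcd {a | ∃ d : Fin n → ℕ, d i = a ∧ orderedMonomial x d ∈ Subring.center S}

/-- The ozone Jacobian: the product of the `x_i ^ (f_i - 1)`. -/
noncomputable def ozoneJacobian {S : Type*} [Ring S] {n : ℕ} (x : Fin n → S) : S :=
  orderedMonomial x fun i => ozoneExponent x i - 1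

/-- The ozone arrangement: the product of the `x_i` over all `i` with `f_i > 1`. -/
noncomputable def ozoneArrangement {S : Type*} [Ring S] {n : ℕ} (x : Fin n → S) : S :=
  orderedMonomial x fun i => if 1 < ozoneExponent x i then 1 else 0

/-- The ozone discriminant: the product of the `x_i ^ f_i` over all `i` with `f_i > 1`. -/
noncomputable def ozoneDiscriminant {S : Type*} [Ring S] {n : ℕ} (x : Fin n → S) : S :=
  orderedMonomial x fun i => if 1 < ozoneExponent x i then ozoneExponent x i else 0

/-- The multiset `{f_1, …, f_n}`. -/
noncomputable def ozoneExponents {S : Type*} [Ring S] {n : ℕ} (x : Fin n → S) : Multiset ℕ :=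
  (Finset.univ : Finset (Fin n)).val.map (ozoneExponent x)

end OzoneSkew

/-! Reflections recover the generators intrinsically. Ordered monomials form a basis of `S`
(`linearIndependent`, `span_eq_top`) and multiply up to nonzero scalars, so a factor of a monomial
is a monomial (`scalarEq_of_mul`), and the center is spanned by monomials. If `ζ` has order `f_i`,
scaling `x_i` by `ζ` and fixing the other generators gives an endomorphism `σ` that fixes the center
and moves every element by a multiple of `x_i` (`exists_reflection`).

Now let `y` be another presentation. Its parameters are again roots of unity, because finiteness
over the center is intrinsic (`isRoot_of_isRoot`). Hence some `y_j ^ N` is central, so `σ` preserves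
`(y_j) ^ N`, and therefore scales each `y_j`. If `f_i > 1`, some `y_j` is scaled nontrivially; it is
then divisible by `x_i`, so it equals `x_i` up to a scalar (`exists_scalarEq_gen`). As `σ` fixes
central monomials in `y`, `f_i` divides `f'_j`, and symmetry gives equality.

The two presentations have equally many generators (`card_le`), so this matching extends to a
bijection of indices, the unmatched exponents all being 1. The three ozone elements involve only
matched generators. -/

namespace OzoneSkew

/-- Equality up to a nonzero scalar. -/
def ScalarEq (k : Type*) [Field k] {S : Type*} [Ring S] [Algebra k S] (a b : S) : Prop :=
  ∃ c : k, c ≠ 0 ∧ a = c • b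

/-! ### Equality up to nonzero scalars -/

namespace ScalarEq

variable {k : Type*} [Field k] {S : Type*} [Ring S] [Algebra k S] {a b c d : S}

theorem refl (a : S) : ScalarEq k a a := ⟨1, one_ne_zero, (one_smul _ _).symm⟩

theorem symm (h : ScalarEq k a b) : ScalarEq k b a := by
  obtain ⟨r, hr, rfl⟩ := h
  exact ⟨r⁻¹, inv_ne_zero hr, by rw [smul_smul, inv_mul_cancel₀ hr, one_smul]⟩

theorem trans (h : ScalarEq k a b) (h' : ScalarEq k b c) : ScalarEq k a c := by
  obtain ⟨r, hr, rfl⟩ := h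
  obtain ⟨r', hr', rfl⟩ := h'
  exact ⟨r * r', mul_ne_zero hr hr', by rw [smul_smul]⟩

theorem mul (h : ScalarEq k a b) (h' : ScalarEq k c d) : ScalarEq k (a * c) (b * d) := by
  obtain ⟨r, hr, rfl⟩ := h
  obtain ⟨r', hr', rfl⟩ := h'
  exact ⟨r * r', mul_ne_zero hr hr', by rw [smul_mul_smul_comm]⟩

theorem pow (h : ScalarEq k a b) (N : ℕ) : ScalarEq k (a ^ N) (b ^ N) := by
  induction N with
  | zero => simpa using refl 1
  | succ N ih => simpa [pow_succ] using ih.mul h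

end ScalarEq

/-! ### Ordered monomials in skew-commuting families -/

section Monomials

variable {k : Type*} [Field k] {S : Type*} [Ring S] [Algebra k S]

/-- `a` and `b` commute up to a nonzero scalar. -/
def SkewCommute (k : Type*) [Field k] {S : Type*} [Ring S] [Algebra k S] (a b : S) : Prop :=
  ScalarEq k (a * b) (b * a)

theorem SkewCommute.symm {a b : S} (h : SkewCommute k a b) : SkewCommute k b a :=
  ScalarEq.symm h

theorem SkewCommute.one_left (b : S) : SkewCommute k 1 b := by
  simpa [SkewCommute] using ScalarEq.refl (k := k) b

theorem SkewCommute.mul_left {a b c : S} (ha : SkewCommute k a c) (hb : SkewCommute k b c) :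
    SkewCommute k (a * b) c := by
  have h1 : ScalarEq k (a * (b * c)) (a * (c * b)) := (ScalarEq.refl a).mul hb
  have h2 : ScalarEq k (a * c * b) (c * a * b) := ScalarEq.mul ha (ScalarEq.refl b)
  have := h1.trans (by simpa [mul_assoc] using h2)
  simpa [SkewCommute, mul_assoc] using this

theorem SkewCommute.pow_left {a b : S} (h : SkewCommute k a b) (N : ℕ) :
    SkewCommute k (a ^ N) b := by
  induction N with
  | zero => simpa using SkewCommute.one_left b
  | succ N ih => simpa [pow_succ] using ih.mul_left h

theorem SkewCommute.list_prod_left {b : S} (l : List S) (h : ∀ a ∈ l, SkewCommute k a b) :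
    SkewCommute k l.prod b := by
  induction l with
  | nil => simpa using SkewCommute.one_left b
  | cons a l ih =>
    rw [List.prod_cons]
    exact (h a (by simp)).mul_left (ih fun c hc => h c (by simp [hc]))

theorem orderedMonomial_succ {n : ℕ} (x : Fin (n + 1) → S) (d : Fin (n + 1) → ℕ) :
    orderedMonomial x d = x 0 ^ d 0 * orderedMonomial (Fin.tail x) (Fin.tail d) := by
  simp [orderedMonomial, List.ofFn_succ, Fin.tail]

theorem orderedMonomial_zero {n : ℕ} (x : Fin n → S) : orderedMonomial x 0 = 1 := by
  refine List.prod_eq_one fun a ha => ?_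
  obtain ⟨i, rfl⟩ := (List.mem_ofFn' _ _).1 ha
  simp

theorem orderedMonomial_single {n : ℕ} (x : Fin n → S) (i : Fin n) (N : ℕ) :
    orderedMonomial x (Pi.single i N) = x i ^ N := by
  induction n with
  | zero => exact i.elim0
  | succ n ih =>
    rw [orderedMonomial_succ]
    refine Fin.cases ?_ (fun i => ?_) i
    · have : Fin.tail (Pi.single (0 : Fin (n + 1)) N : Fin (n + 1) → ℕ) = 0 := by
        ext j; simp [Fin.tail]
      rw [this, orderedMonomial_zero]
      simp
    · have : Fin.tail (Pi.single i.succ N : Fin (n + 1) → ℕ) = Pi.single i N := by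
        ext j; simp [Fin.tail, Pi.single_apply]
      rw [this, ih]
      simp [Fin.tail]

/-- Moving `x 0 ^ e 0` past the tail of the first monomial costs only a scalar; induction handles
the tails. The scalar itself is never needed. -/
theorem orderedMonomial_mul {n : ℕ} (x : Fin n → S) (h : ∀ i j, SkewCommute k (x i) (x j))
    (d e : Fin n → ℕ) :
    ScalarEq k (orderedMonomial x d * orderedMonomial x e) (orderedMonomial x (d + e)) := by
  induction n with
  | zero => simpa [orderedMonomial] using ScalarEq.refl (k := k) (1 : S)
  | succ n ih =>
    simp only [orderedMonomial_succ]
    have h1 : SkewCommute k (orderedMonomial (Fin.tail x) (Fin.tail d)) (x 0 ^ e 0) := by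
      refine SkewCommute.list_prod_left _ fun a ha => ?_
      obtain ⟨i, rfl⟩ := (List.mem_ofFn' _ _).1 ha
      exact ((((h i.succ 0).pow_left _).symm).pow_left _).symm
    have h2 := ((ScalarEq.refl (k := k) (x 0 ^ d 0)).mul h1).mul
      (ScalarEq.refl (k := k) (orderedMonomial (Fin.tail x) (Fin.tail e)))
    have h3 := (ScalarEq.refl (k := k) (x 0 ^ d 0 * x 0 ^ e 0)).mul
      (ih (Fin.tail x) (fun i j => h _ _) (Fin.tail d) (Fin.tail e))
    rw [← pow_add] at h3
    refine ScalarEq.trans ?_ h3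
    simpa [mul_assoc, pow_add] using h2

theorem map_orderedMonomial {T : Type*} [Ring T] {F : Type*} [FunLike F S T]
    [MonoidHomClass F S T] (f : F) {n : ℕ} (x : Fin n → S) (d : Fin n → ℕ) :
    f (orderedMonomial x d) = orderedMonomial (fun i => f (x i)) d := by
  simp only [orderedMonomial, map_list_prod, List.map_ofFn]
  congr 2
  ext i
  simp

theorem orderedMonomial_mem_center {n : ℕ} (x : Fin n → S) (d : Fin n → ℕ)
    (h : ∀ i, x i ^ d i ∈ Subring.center S) : orderedMonomial x d ∈ Subring.center S := by
  refine Subring.list_prod_mem _ fun a ha => ?_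
  obtain ⟨i, rfl⟩ := (List.mem_ofFn' _ _).1 ha
  exact h i

end Monomials

theorem IsMulAntisymm.ne_zero {k : Type*} [Field k] {n : ℕ} {p : Matrix (Fin n) (Fin n) k}
    (hp : IsMulAntisymm p) (i j : Fin n) : p i j ≠ 0 := fun h => by
  have := hp.mul_swap i j
  simp [h] at this

/-! ### The monomial basis of a skew polynomial ring -/

namespace IsSkewGenerators

variable {k : Type*} [Field k] {S : Type*} [Ring S] [Algebra k S] {n : ℕ}
  {p : Matrix (Fin n) (Fin n) k} {x : Fin n → S}

theorem map {T : Type*} [Ring T] [Algebra k T] (hx : IsSkewGenerators p x) (φ : S ≃ₐ[k] T) :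
    IsSkewGenerators p (fun i => φ (x i)) := by
  obtain ⟨e, he⟩ := hx
  exact ⟨e.trans φ, fun i => by simp [he]⟩

theorem rel (hx : IsSkewGenerators p x) (i j : Fin n) :
    x j * x i = p i j • (x i * x j) := by
  obtain ⟨e, he⟩ := hx
  have := RingQuot.mkAlgHom_rel k (SkewRel.comm (p := p) i j)
  simp only [map_mul, map_smul] at this
  have h2 := congrArg e this
  simp only [map_mul, map_smul] at h2
  simpa only [← he, SkewPoly.gen] using h2

/-- The universal property, from which come the regular representation, the diagonal endomorphisms
and the tangent-space map. -/
theorem exists_lift (hx : IsSkewGenerators p x) {A : Type*} [Ring A] [Algebra k A]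
    (a : Fin n → A) (ha : ∀ i j, a j * a i = p i j • (a i * a j)) :
    ∃ f : S →ₐ[k] A, ∀ i, f (x i) = a i := by
  obtain ⟨e, he⟩ := hx
  let f : SkewPoly p →ₐ[k] A := RingQuot.liftAlgHom k ⟨FreeAlgebra.lift k a, by
    rintro _ _ ⟨i, j⟩
    simpa using ha i j⟩
  refine ⟨f.comp e.symm.toAlgHom, fun i => ?_⟩
  have : e.symm (x i) = SkewPoly.gen p i := by rw [← he, AlgEquiv.symm_apply_apply]
  simp [this, f, SkewPoly.gen]

theorem adjoin_eq_top (hx : IsSkewGenerators p x) : Algebra.adjoin k (Set.range x) = ⊤ := by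
  obtain ⟨e, he⟩ := hx
  let f : FreeAlgebra k (Fin n) →ₐ[k] S := e.toAlgHom.comp (RingQuot.mkAlgHom k (SkewRel p))
  have hf : Function.Surjective f :=
    e.surjective.comp (RingQuot.mkAlgHom_surjective k (SkewRel p))
  have h1 : (Algebra.adjoin k (Set.range (FreeAlgebra.ι k : Fin n → _))).map f = ⊤ := by
    rw [FreeAlgebra.adjoin_range_ι, Algebra.map_top, AlgHom.range_eq_top]
    exact hf
  rw [AlgHom.map_adjoin, ← Set.range_comp] at h1
  convert h1 using 3
  ext i
  exact (he i).symm

theorem skewCommute (hp : IsMulAntisymm p) (hx : IsSkewGenerators p x) (i j : Fin n) :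
    SkewCommute k (x i) (x j) :=
  ⟨p j i, hp.ne_zero j i, hx.rel j i⟩

theorem monomial_mul (hp : IsMulAntisymm p) (hx : IsSkewGenerators p x) (d e : Fin n → ℕ) :
    ScalarEq k (orderedMonomial x d * orderedMonomial x e) (orderedMonomial x (d + e)) :=
  orderedMonomial_mul x (hx.skewCommute hp) d e

theorem span_eq_top (hp : IsMulAntisymm p) (hx : IsSkewGenerators p x) :
    Submodule.span k (Set.range (orderedMonomial x)) = ⊤ := by
  rw [eq_top_iff]
  intro s _
  have hs : s ∈ Algebra.adjoin k (Set.range x) := by rw [hx.adjoin_eq_top]; trivial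
  have hone : (1 : S) ∈ Submodule.span k (Set.range (orderedMonomial x)) :=
    Submodule.subset_span ⟨0, orderedMonomial_zero x⟩
  induction hs using Algebra.adjoin_induction with
  | mem s hs =>
    obtain ⟨i, rfl⟩ := hs
    exact Submodule.subset_span ⟨Pi.single i 1, by simp [orderedMonomial_single]⟩
  | algebraMap r =>
    rw [Algebra.algebraMap_eq_smul_one]
    exact Submodule.smul_mem _ _ hone
  | add a b _ _ ha hb => exact Submodule.add_mem _ (ha trivial) (hb trivial)
  | mul a b _ _ ha hb =>
    have := Submodule.mul_mem_mul (ha trivial) (hb trivial)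
    rw [Submodule.span_mul_span] at this
    refine Submodule.span_le.2 ?_ this
    rintro _ ⟨_, ⟨d, rfl⟩, _, ⟨e, rfl⟩, rfl⟩
    obtain ⟨c, -, hc⟩ := hx.monomial_mul hp d e
    simp only [hc]
    exact Submodule.smul_mem _ _ (Submodule.subset_span ⟨_, rfl⟩)

/-- The scalar acquired when `x_i` is sorted into `x_1 ^ e_1 * ⋯ * x_n ^ e_n`. -/
def sortScalar (p : Matrix (Fin n) (Fin n) k) (i : Fin n) (e : Fin n → ℕ) : k :=
  ∏ l, if l < i then p l i ^ e l else 1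

theorem sortScalar_add_single (i j : Fin n) (e : Fin n → ℕ) :
    sortScalar p j (e + Pi.single i 1) = sortScalar p j e * if i < j then p i j else 1 := by
  have : (if i < j then p i j else 1) =
      ∏ l, if l < j then p l j ^ (Pi.single i 1 : Fin n → ℕ) l else 1 := by
    rw [Finset.prod_eq_single i]
    · simp
    · intro l _ hl
      simp [hl]
    · simp
  rw [this, sortScalar, sortScalar, ← Finset.prod_mul_distrib]
  refine Finset.prod_congr rfl fun l _ => ?_
  split_ifs <;> simp [pow_add]

theorem sortScalar_ne_zero (hp : IsMulAntisymm p) (i : Fin n) (e : Fin n → ℕ) :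
    sortScalar p i e ≠ 0 := by
  refine Finset.prod_ne_zero_iff.2 fun l _ => ?_
  split_ifs
  · exact pow_ne_zero _ (hp.ne_zero _ _)
  · exact one_ne_zero

/-- Left multiplication by `x_i` in the coordinates given by ordered monomials. -/
noncomputable def leftOp (p : Matrix (Fin n) (Fin n) k) (i : Fin n) :
    Module.End k ((Fin n → ℕ) →₀ k) :=
  Finsupp.linearCombination k fun e => Finsupp.single (e + Pi.single i 1) (sortScalar p i e)

theorem leftOp_single (i : Fin n) (e : Fin n → ℕ) (c : k) :
    leftOp p i (Finsupp.single e c) =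
      Finsupp.single (e + Pi.single i 1) (c * sortScalar p i e) := by
  simp [leftOp]

/-- Both composites shift by the same degree. For `i < j` only the left one picks up the extra
factor `p i j`; for `j < i` only the right one picks up `p j i`, which cancels against `p i j`. -/
theorem leftOp_rel (hp : IsMulAntisymm p) (i j : Fin n) :
    leftOp p j * leftOp p i = p i j • (leftOp p i * leftOp p j) := by
  refine Finsupp.lhom_ext fun e c => ?_
  simp only [Module.End.mul_apply, LinearMap.smul_apply, leftOp_single, sortScalar_add_single,
    Finsupp.smul_single, smul_eq_mul]
  rw [add_right_comm]
  congr 1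
  rcases lt_trichotomy i j with h | rfl | h
  · simp only [h, if_true, h.not_gt, if_false]
    ring
  · simp [hp.diag]
  · simp only [h, if_true, h.not_gt, if_false]
    linear_combination (-(c * sortScalar p i e * sortScalar p j e)) * hp.mul_swap i j

theorem leftOp_pow_single (hp : IsMulAntisymm p) (i : Fin n) (N : ℕ) (e : Fin n → ℕ) (c : k)
    (hc : c ≠ 0) :
    ∃ c' : k, c' ≠ 0 ∧ (leftOp p i ^ N) (Finsupp.single e c) =
      Finsupp.single (Pi.single i N + e) c' := by
  induction N with
  | zero => exact ⟨c, hc, by simp⟩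
  | succ N ih =>
    obtain ⟨c', hc', h⟩ := ih
    refine ⟨_, mul_ne_zero hc' (sortScalar_ne_zero hp i (Pi.single i N + e)), ?_⟩
    rw [pow_succ', Module.End.mul_apply, h, leftOp_single, add_right_comm, ← Pi.single_add]

theorem list_leftOp_single (hp : IsMulAntisymm p) (d : Fin n → ℕ) (l : List (Fin n)) :
    ∃ c : k, c ≠ 0 ∧ (l.map fun i => leftOp p i ^ d i).prod (Finsupp.single 0 1) =
      Finsupp.single (l.map fun i => (Pi.single i (d i) : Fin n → ℕ)).sum c := by
  induction l with
  | nil => exact ⟨1, one_ne_zero, by simp⟩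
  | cons i l ih =>
    obtain ⟨c, hc, h⟩ := ih
    obtain ⟨c', hc', h'⟩ := leftOp_pow_single hp i (d i)
      (l.map fun i => (Pi.single i (d i) : Fin n → ℕ)).sum c hc
    exact ⟨c', hc', by simp only [List.map_cons, List.prod_cons, List.sum_cons,
      Module.End.mul_apply, h, h']⟩

/-- The operators `leftOp` represent `S` on a space with basis indexed by exponents. Applied to the
basis vector at `0`, distinct monomials yield nonzero multiples of distinct basis vectors. -/
theorem linearIndependent (hp : IsMulAntisymm p) (hx : IsSkewGenerators p x) :
    LinearIndependent k (orderedMonomial x) := by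
  obtain ⟨ρ, hρ⟩ := hx.exists_lift (leftOp p) (leftOp_rel hp)
  let Ψ : S →ₗ[k] ((Fin n → ℕ) →₀ k) :=
    (LinearMap.applyₗ (Finsupp.single 0 1)).comp ρ.toLinearMap
  have hΨ : ∀ d : Fin n → ℕ, ∃ c : k, c ≠ 0 ∧ Ψ (orderedMonomial x d) = Finsupp.single d c := by
    intro d
    obtain ⟨c, hc, h⟩ := list_leftOp_single hp d (List.finRange n)
    refine ⟨c, hc, ?_⟩
    have h1 : Ψ (orderedMonomial x d) =
        orderedMonomial (fun i => ρ (x i)) d (Finsupp.single 0 1) := by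
      simp [Ψ, map_orderedMonomial]
    have h2 : ((List.finRange n).map fun i => (Pi.single i (d i) : Fin n → ℕ)).sum = d := by
      rw [← List.ofFn_eq_map, List.sum_ofFn]
      exact Finset.univ_sum_single d
    rw [h1, orderedMonomial, List.ofFn_eq_map]
    simp only [hρ]
    rw [h, h2]
  choose c hc h using hΨ
  refine LinearIndependent.of_comp Ψ ?_
  have := (Finsupp.basisSingleOne (R := k) (ι := Fin n → ℕ)).linearIndependent.units_smul
    (fun d => Units.mk0 (c d) (hc d))
  convert this using 1
  ext1 d
  simp [h, Units.smul_def]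

/-- The basis of ordered monomials. -/
noncomputable def basis (hp : IsMulAntisymm p) (hx : IsSkewGenerators p x) :
    Module.Basis (Fin n → ℕ) k S :=
  Module.Basis.mk (hx.linearIndependent hp) (hx.span_eq_top hp).ge

theorem basis_apply (hp : IsMulAntisymm p) (hx : IsSkewGenerators p x) (d : Fin n → ℕ) :
    hx.basis hp d = orderedMonomial x d := by
  simp [basis]

end IsSkewGenerators

end OzoneSkew

/-! ### Factors of monomials and the center -/

namespace OzoneSkew

namespace IsSkewGenerators

variable {k : Type*} [Field k] {S : Type*} [Ring S] [Algebra k S] {n : ℕ}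
  {p : Matrix (Fin n) (Fin n) k} {x : Fin n → S}

theorem repr_monomial (hp : IsMulAntisymm p) (hx : IsSkewGenerators p x) (d : Fin n → ℕ) :
    (hx.basis hp).repr (orderedMonomial x d) = Finsupp.single d 1 := by
  rw [← hx.basis_apply hp, Module.Basis.repr_self]

theorem monomial_ne_zero (hp : IsMulAntisymm p) (hx : IsSkewGenerators p x) (d : Fin n → ℕ) :
    orderedMonomial x d ≠ 0 := by
  rw [← hx.basis_apply hp]
  exact Module.Basis.ne_zero _ d

theorem eq_of_scalarEq (hp : IsMulAntisymm p) (hx : IsSkewGenerators p x) {d e : Fin n → ℕ}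
    (h : ScalarEq k (orderedMonomial x d) (orderedMonomial x e)) : d = e := by
  obtain ⟨c, hc, h⟩ := h
  have := congrArg (hx.basis hp).repr h
  rw [map_smul, repr_monomial, repr_monomial, Finsupp.smul_single,
    Finsupp.single_eq_single_iff] at this
  exact (this.resolve_right fun h => one_ne_zero h.1).1

theorem eq_sum (hp : IsMulAntisymm p) (hx : IsSkewGenerators p x) (s : S) :
    s = ((hx.basis hp).repr s).sum fun d c => c • orderedMonomial x d := by
  conv_lhs => rw [← (hx.basis hp).linearCombination_repr s, Finsupp.linearCombination_apply]
  simp only [basis_apply]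

/-- Coordinates of a product at a degree that arises from only one pair of monomials. -/
theorem repr_mul_ne_zero (hp : IsMulAntisymm p) (hx : IsSkewGenerators p x) {s t : S}
    {α β : Fin n → ℕ} (hα : α ∈ ((hx.basis hp).repr s).support)
    (hβ : β ∈ ((hx.basis hp).repr t).support)
    (h : UniqueAdd ((hx.basis hp).repr s).support ((hx.basis hp).repr t).support α β) :
    (hx.basis hp).repr (s * t) (α + β) ≠ 0 := by
  choose c hc hmul using hx.monomial_mul hp
  have hst : (hx.basis hp).repr (s * t) (α + β) =
      (hx.basis hp).repr s α * (hx.basis hp).repr t β * c α β := by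
    conv_lhs => rw [hx.eq_sum hp s, hx.eq_sum hp t]
    simp only [Finsupp.sum, Finset.sum_mul_sum, map_sum, smul_mul_smul_comm,
      map_smul, hmul, repr_monomial, Finsupp.finsetSum_apply, Finsupp.smul_apply]
    rw [Finset.sum_eq_single α, Finset.sum_eq_single β]
    · simp [mul_assoc]
    · intro e he hne
      rw [Finsupp.single_eq_of_ne]
      · simp
      · exact fun h' => hne (h hα he h'.symm).2
    · exact fun h' => absurd hβ h'
    · intro d hd hne
      refine Finset.sum_eq_zero fun e he => ?_
      rw [Finsupp.single_eq_of_ne]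
      · simp
      · exact fun h' => hne (h hd he h'.symm).1
    · exact fun h' => absurd hα h'
  rw [hst]
  exact mul_ne_zero (mul_ne_zero (Finsupp.mem_support_iff.1 hα) (Finsupp.mem_support_iff.1 hβ))
    (hc _ _)

theorem scalarEq_of_support_card_eq_one (hp : IsMulAntisymm p) (hx : IsSkewGenerators p x) {s : S}
    (h : ((hx.basis hp).repr s).support.card = 1) :
    ∃ d, ScalarEq k s (orderedMonomial x d) := by
  obtain ⟨d, c, hc, h⟩ := Finsupp.card_support_eq_one'.1 h
  refine ⟨d, c, hc, ?_⟩
  rw [hx.eq_sum hp s, h, Finsupp.sum_single_index (by simp)]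

/-- The factors of a monomial are monomials, up to scalars. -/
theorem scalarEq_of_mul (hp : IsMulAntisymm p) (hx : IsSkewGenerators p x) {s t : S}
    {δ : Fin n → ℕ} (h : ScalarEq k (s * t) (orderedMonomial x δ)) :
    ∃ α β, ScalarEq k s (orderedMonomial x α) ∧ ScalarEq k t (orderedMonomial x β) ∧
      α + β = δ := by
  have hne : s * t ≠ 0 := by
    obtain ⟨c, hc, h⟩ := h
    rw [h]
    exact smul_ne_zero hc (hx.monomial_ne_zero hp δ)
  set A := ((hx.basis hp).repr s).support with hA
  set B := ((hx.basis hp).repr t).support with hB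
  have hA0 : 0 < A.card := by
    rw [Finset.card_pos, hA, Finsupp.support_nonempty_iff]
    rintro h0
    rw [LinearEquiv.map_eq_zero_iff] at h0
    exact hne (by rw [h0, zero_mul])
  have hB0 : 0 < B.card := by
    rw [Finset.card_pos, hB, Finsupp.support_nonempty_iff]
    rintro h0
    rw [LinearEquiv.map_eq_zero_iff] at h0
    exact hne (by rw [h0, mul_zero])
  have hsupp : ∀ γ, (hx.basis hp).repr (s * t) γ ≠ 0 → γ = δ := by
    intro γ hγ
    obtain ⟨c, hc, h⟩ := h
    by_contra hne
    rw [h, map_smul, repr_monomial, Finsupp.smul_single, Finsupp.single_eq_of_ne hne] at hγ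
    exact hγ rfl
  -- Otherwise two different pairs of exponents would have uniquely represented sums, and the
  -- product would contain two different monomials.
  have hcard : A.card * B.card = 1 := by
    by_contra hne1
    have hlt : 1 < A.card * B.card := by
      have := Nat.mul_pos hA0 hB0
      omega
    obtain ⟨a, ha, b, hb, hab, hua, hub⟩ := TwoUniqueSums.uniqueAdd_of_one_lt_card hlt
    rw [Finset.mem_product] at ha hb
    have h1 := hsupp _ (hx.repr_mul_ne_zero hp ha.1 ha.2 hua)
    have h2 := hsupp _ (hx.repr_mul_ne_zero hp hb.1 hb.2 hub)
    obtain ⟨h3, h4⟩ := hub ha.1 ha.2 (h1.trans h2.symm)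
    exact hab (Prod.ext h3 h4)
  obtain ⟨hcA, hcB⟩ := mul_eq_one.1 hcard
  obtain ⟨α, hα⟩ := hx.scalarEq_of_support_card_eq_one hp hcA
  obtain ⟨β, hβ⟩ := hx.scalarEq_of_support_card_eq_one hp hcB
  refine ⟨α, β, hα, hβ, hx.eq_of_scalarEq hp ?_⟩
  exact ((hα.mul hβ).trans (hx.monomial_mul hp α β)).symm.trans h

/-- As a factor of the monomial `x i ^ N`, `s` is itself a monomial up to a scalar, and comparing
exponents of the `N`-th powers determines it. -/
theorem scalarEq_gen_of_pow_eq (hp : IsMulAntisymm p) (hx : IsSkewGenerators p x) {s : S}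
    {i : Fin n} {N : ℕ} (hN : 0 < N) (h : s ^ N = x i ^ N) : ScalarEq k s (x i) := by
  have hpow : ∀ (α : Fin n → ℕ) (M : ℕ),
      ScalarEq k (orderedMonomial x α ^ M) (orderedMonomial x (M • α)) := by
    intro α M
    induction M with
    | zero => simpa [orderedMonomial_zero] using ScalarEq.refl (k := k) (1 : S)
    | succ M ih =>
      rw [pow_succ, succ_nsmul]
      exact (ih.mul (ScalarEq.refl _)).trans (hx.monomial_mul hp _ _)
  obtain ⟨M, rfl⟩ := Nat.exists_eq_succ_of_ne_zero hN.ne'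
  have h' : ScalarEq k (s * s ^ M) (orderedMonomial x (Pi.single i (M + 1))) := by
    rw [← pow_succ', h, orderedMonomial_single]
    exact ScalarEq.refl _
  obtain ⟨α, -, hα, -, -⟩ := hx.scalarEq_of_mul hp h'
  have h2 : (M + 1) • α = Pi.single i (M + 1) := by
    refine hx.eq_of_scalarEq hp (((hα.pow (M + 1)).trans (hpow α (M + 1))).symm.trans ?_)
    rw [h, orderedMonomial_single]
    exact ScalarEq.refl _
  have h3 : α = Pi.single i 1 := by
    ext j
    have := congrFun h2 j
    simp only [Pi.smul_apply, smul_eq_mul, Pi.single_apply] at this ⊢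
    split_ifs at this ⊢ <;> simpa using this
  rwa [h3, orderedMonomial_single, pow_one] at hα

theorem mem_center_of_forall_commute (hx : IsSkewGenerators p x) {s : S}
    (h : ∀ i, s * x i = x i * s) : s ∈ Subring.center S := by
  rw [Subring.mem_center_iff]
  intro g
  have hg : g ∈ Algebra.adjoin k (Set.range x) := by rw [hx.adjoin_eq_top]; trivial
  have hle : Algebra.adjoin k (Set.range x) ≤ Subalgebra.centralizer k {s} := by
    refine Algebra.adjoin_le ?_
    rintro _ ⟨i, rfl⟩
    exact (Subalgebra.mem_centralizer_iff k).2 fun g hg => by rw [Set.mem_singleton_iff.1 hg, h]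
  exact ((Subalgebra.mem_centralizer_iff k).1 (hle hg) s rfl).symm

/-- The center is spanned by monomials. -/
theorem monomial_mem_center_of_repr_ne_zero (hp : IsMulAntisymm p) (hx : IsSkewGenerators p x)
    {z : S} (hz : z ∈ Subring.center S) {d : Fin n → ℕ} (hd : (hx.basis hp).repr z d ≠ 0) :
    orderedMonomial x d ∈ Subring.center S := by
  refine hx.mem_center_of_forall_commute fun i => ?_
  have hcomm : ∀ e, ScalarEq k (orderedMonomial x e * x i) (x i * orderedMonomial x e) := by
    intro e
    have := SkewCommute.list_prod_left (k := k) (b := x i) (List.ofFn fun i => x i ^ e i)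
      fun a ha => by
        obtain ⟨j, rfl⟩ := (List.mem_ofFn' _ _).1 ha
        exact (hx.skewCommute hp j i).pow_left _
    exact this
  have hmul : ∀ e, ScalarEq k (x i * orderedMonomial x e)
      (orderedMonomial x (Pi.single i 1 + e)) := by
    intro e
    have := hx.monomial_mul hp (Pi.single i 1) e
    rwa [orderedMonomial_single, pow_one] at this
  choose γ hγ hγe using hcomm
  choose μ hμ hμe using hmul
  -- Multiplication by `x i` on either side shifts degrees injectively, so this coordinate sees only
  -- the degree `d` part of `z`. Comparing with `x i * z` forces the commutation scalar `γ d` to be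
  -- 1.
  have h1 : ((hx.basis hp).repr (z * x i)) (Pi.single i 1 + d) =
      (hx.basis hp).repr z d * (γ d * μ d) := by
    conv_lhs => rw [hx.eq_sum hp z]
    simp only [Finsupp.sum, Finset.sum_mul, map_sum, smul_mul_assoc, hγe, hμe, smul_smul,
      map_smul, repr_monomial, Finsupp.finsetSum_apply, Finsupp.smul_apply]
    rw [Finset.sum_eq_single d]
    · simp
    · intro e _ hne
      rw [Finsupp.single_eq_of_ne (by simpa using hne.symm)]
      simp
    · intro h
      simp [Finsupp.notMem_support_iff.1 h]
  have h2 : ((hx.basis hp).repr (x i * z)) (Pi.single i 1 + d) =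
      (hx.basis hp).repr z d * μ d := by
    conv_lhs => rw [hx.eq_sum hp z]
    simp only [Finsupp.sum, Finset.mul_sum, map_sum, mul_smul_comm, hμe, smul_smul,
      map_smul, repr_monomial, Finsupp.finsetSum_apply, Finsupp.smul_apply]
    rw [Finset.sum_eq_single d]
    · simp
    · intro e _ hne
      rw [Finsupp.single_eq_of_ne (by simpa using hne.symm)]
      simp
    · intro h
      simp [Finsupp.notMem_support_iff.1 h]
  rw [← Subring.mem_center_iff.1 hz (x i), h2] at h1
  have h3 := mul_left_cancel₀ hd h1
  have h4 : γ d = 1 := mul_right_cancel₀ (hμ d) (by rw [← h3, one_mul])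
  rw [hγe, h4, one_smul]

theorem gen_pow_mul (hx : IsSkewGenerators p x) (i j : Fin n) (N : ℕ) :
    x j ^ N * x i = p i j ^ N • (x i * x j ^ N) := by
  induction N with
  | zero => simp
  | succ N ih =>
    rw [pow_succ', mul_assoc, ih, mul_smul_comm, ← mul_assoc, hx.rel i j, smul_mul_assoc,
      smul_smul, mul_assoc, ← pow_succ', ← pow_succ]

theorem gen_pow_mem_center_iff (hp : IsMulAntisymm p) (hx : IsSkewGenerators p x) (j : Fin n)
    (N : ℕ) : x j ^ N ∈ Subring.center S ↔ ∀ i, p i j ^ N = 1 := by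
  constructor
  · intro h i
    have h1 := hx.gen_pow_mul i j N
    rw [← Subring.mem_center_iff.1 h] at h1
    obtain ⟨c, hc, h2⟩ := hx.monomial_mul hp (Pi.single i 1) (Pi.single j N)
    rw [orderedMonomial_single, orderedMonomial_single, pow_one] at h2
    rw [h2] at h1
    have h3 : c • orderedMonomial x (Pi.single i 1 + Pi.single j N) ≠ 0 :=
      smul_ne_zero hc (hx.monomial_ne_zero hp _)
    exact smul_left_injective k h3 (by simpa using h1.symm)
  · intro h
    refine hx.mem_center_of_forall_commute fun i => ?_
    rw [hx.gen_pow_mul, h, one_smul]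

end IsSkewGenerators

end OzoneSkew

/-! ### Finiteness over the center, ozone exponents and reflections -/

namespace OzoneSkew

/-- In a commutative group, the lcm of two finite orders is again the order of an element; adjoin
the `g i` one at a time. -/
theorem exists_orderOf_forall_pow_eq_one {k ι : Type*} [Field k] (g : ι → k) (s : Finset ι)
    (hg : ∀ i ∈ s, ∃ r : ℕ, 0 < r ∧ g i ^ r = 1) :
    ∃ ζ : k, 0 < orderOf ζ ∧ ∀ i ∈ s, g i ^ orderOf ζ = 1 := by
  classical
  induction s using Finset.induction_on with
  | empty => exact ⟨1, by simp, by simp⟩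
  | insert a s ha ih =>
    obtain ⟨ζ, hζ, h⟩ := ih fun i hi => hg i (Finset.mem_insert_of_mem hi)
    obtain ⟨r, hr, hra⟩ := hg a (Finset.mem_insert_self _ _)
    have ha0 : 0 < orderOf (g a) := orderOf_pos_iff.2 (isOfFinOrder_iff_pow_eq_one.2 ⟨r, hr, hra⟩)
    obtain ⟨ξ, hξ⟩ : ∃ ξ : k, orderOf ξ = Nat.lcm (orderOf ζ) (orderOf (g a)) :=
      ⟨_, (Commute.all ζ (g a)).orderOf_mul_pow_eq_lcm hζ.ne' ha0.ne'⟩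
    refine ⟨ξ, hξ ▸ Nat.lcm_pos hζ ha0, fun i hi => ?_⟩
    rw [hξ]
    rcases Finset.mem_insert.1 hi with rfl | hi
    · exact orderOf_dvd_iff_pow_eq_one.1 (Nat.dvd_lcm_right _ _)
    · obtain ⟨c, hc⟩ := Nat.dvd_lcm_left (orderOf ζ) (orderOf (g a))
      rw [hc, pow_mul, h i hi, one_pow]

namespace IsSkewGenerators

variable {k : Type*} [Field k] {S : Type*} [Ring S] [Algebra k S] {n : ℕ}
  {p : Matrix (Fin n) (Fin n) k} {x : Fin n → S}

theorem exists_pow_mem_center (hp : IsMulAntisymm p) (hx : IsSkewGenerators p x)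
    (hroot : ∀ i j, ∃ r : ℕ, 0 < r ∧ p i j ^ r = 1) :
    ∃ N : ℕ, 0 < N ∧ ∀ j, x j ^ N ∈ Subring.center S := by
  choose r hr hpr using hroot
  refine ⟨∏ i, ∏ j, r i j, Finset.prod_pos fun i _ => Finset.prod_pos fun j _ => hr i j,
    fun j => (hx.gen_pow_mem_center_iff hp j _).2 fun i => ?_⟩
  obtain ⟨c, hc⟩ : r i j ∣ ∏ i, ∏ j, r i j :=
    (Finset.dvd_prod_of_mem (r i) (Finset.mem_univ j)).trans
      (Finset.dvd_prod_of_mem (fun i => ∏ j, r i j) (Finset.mem_univ i))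
  rw [hc, pow_mul, hpr, one_pow]

/-- With all `x j ^ N` central, dividing exponents by `N` leaves finitely many monomials, those with
exponents below `N`, as module generators. -/
theorem finite_over_center (hp : IsMulAntisymm p) (hx : IsSkewGenerators p x)
    (hroot : ∀ i j, ∃ r : ℕ, 0 < r ∧ p i j ^ r = 1) :
    Module.Finite (Subring.center S) S := by
  obtain ⟨N, hN, hc⟩ := hx.exists_pow_mem_center hp hroot
  let b : (Fin n → Fin N) → S := fun r => orderedMonomial x fun i => (r i : ℕ)
  refine ⟨Submodule.fg_def.2 ⟨_, Set.finite_range b, eq_top_iff.2 fun s _ => ?_⟩⟩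
  have hs : s ∈ Submodule.span k (Set.range (orderedMonomial x)) := by
    rw [hx.span_eq_top hp]
    trivial
  have hsmul : ∀ (c : k), ∀ t ∈ Submodule.span (Subring.center S) (Set.range b),
      c • t ∈ Submodule.span (Subring.center S) (Set.range b) := by
    intro c t ht
    have hc : algebraMap k S c ∈ Subring.center S :=
      Subring.mem_center_iff.2 fun g => (Algebra.commutes c g).symm
    have : c • t = (⟨_, hc⟩ : Subring.center S) • t := Algebra.smul_def c t
    rw [this]
    exact Submodule.smul_mem _ _ ht
  induction hs using Submodule.span_induction with
  | mem s hs =>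
    obtain ⟨d, rfl⟩ := hs
    obtain ⟨c, -, h⟩ := (hx.monomial_mul hp (fun i => N * (d i / N)) fun i => d i % N).symm
    have hd : ((fun i => N * (d i / N)) + fun i => d i % N) = d :=
      funext fun i => Nat.div_add_mod _ _
    have hz : orderedMonomial x (fun i => N * (d i / N)) ∈ Subring.center S :=
      orderedMonomial_mem_center x _ fun i => by
        rw [pow_mul]
        exact Subring.pow_mem _ (hc i) _
    rw [hd] at h
    rw [h]
    refine hsmul c _ ?_
    exact Submodule.smul_mem _ (⟨_, hz⟩ : Subring.center S)
      (Submodule.subset_span ⟨fun i => ⟨d i % N, Nat.mod_lt _ hN⟩, rfl⟩)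
  | zero => exact Submodule.zero_mem _
  | add s t _ _ hs ht => exact Submodule.add_mem _ (hs trivial) (ht trivial)
  | smul c s _ hs => exact hsmul c s (hs trivial)

theorem exists_gen_pow_mem_center (hp : IsMulAntisymm p) (hx : IsSkewGenerators p x)
    (hfin : Module.Finite (Subring.center S) S) (j : Fin n) :
    ∃ N : ℕ, 0 < N ∧ x j ^ N ∈ Subring.center S := by
  obtain ⟨P, hP, hroot⟩ := IsIntegral.of_finite (Subring.center S) (x j)
  rw [Polynomial.eval₂_eq_sum_range, Finset.sum_range_succ, hP.coeff_natDegree, map_one,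
    one_mul] at hroot
  set N := P.natDegree
  -- In a monic equation for `x j` over the center, the leading term must cancel against some `z * x
  -- j ^ r` with `z` central and `r < N`. So `z` contains the monomial `x j ^ (N - r)`, which is
  -- then central.
  have h1 : (hx.basis hp).repr (∑ r ∈ Finset.range N,
      algebraMap (Subring.center S) S (P.coeff r) * x j ^ r) (Pi.single j N) ≠ 0 := by
    rw [eq_neg_of_add_eq_zero_left hroot, ← orderedMonomial_single, map_neg, repr_monomial]
    simp
  rw [map_sum, Finsupp.finsetSum_apply] at h1
  obtain ⟨r, hr, h2⟩ := Finset.exists_ne_zero_of_sum_ne_zero h1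
  rw [Finset.mem_range] at hr
  have hz : algebraMap (Subring.center S) S (P.coeff r) ∈ Subring.center S :=
    (P.coeff r).2
  generalize algebraMap (Subring.center S) S (P.coeff r) = z at h2 hz
  rw [hx.eq_sum hp z, Finsupp.sum, Finset.sum_mul, map_sum, Finsupp.finsetSum_apply] at h2
  obtain ⟨d, hd, h3⟩ := Finset.exists_ne_zero_of_sum_ne_zero h2
  obtain ⟨c, -, hcd⟩ := hx.monomial_mul hp d (Pi.single j r)
  rw [smul_mul_assoc, ← orderedMonomial_single, hcd, map_smul, map_smul, repr_monomial,
    Finsupp.smul_apply, Finsupp.smul_apply] at h3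
  have hsum : Pi.single j N = d + Pi.single j r := by
    by_contra hne
    rw [Finsupp.single_eq_of_ne hne] at h3
    simp at h3
  have hd' : d = Pi.single j (N - r) := by
    ext i
    have := congrFun hsum i
    simp only [Pi.add_apply, Pi.single_apply] at this ⊢
    split_ifs at this ⊢ <;> omega
  refine ⟨N - r, by omega, ?_⟩
  have := hx.monomial_mem_center_of_repr_ne_zero hp hz (Finsupp.mem_support_iff.1 hd)
  rwa [hd', orderedMonomial_single] at this

/-- If one presentation has roots of unity as parameters, so does every other. -/
theorem isRoot_of_isRoot (hp : IsMulAntisymm p) (hx : IsSkewGenerators p x)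
    (hroot : ∀ i j, ∃ r : ℕ, 0 < r ∧ p i j ^ r = 1)
    {m : ℕ} {q : Matrix (Fin m) (Fin m) k} {y : Fin m → S} (hq : IsMulAntisymm q)
    (hy : IsSkewGenerators q y) (i j : Fin m) : ∃ r : ℕ, 0 < r ∧ q i j ^ r = 1 := by
  obtain ⟨N, hN, h⟩ := hy.exists_gen_pow_mem_center hq (hx.finite_over_center hp hroot) j
  exact ⟨N, hN, (hy.gen_pow_mem_center_iff hq j N).1 h i⟩

theorem ozoneExponent_dvd {d : Fin n → ℕ} (h : orderedMonomial x d ∈ Subring.center S)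
    (i : Fin n) : ozoneExponent x i ∣ d i :=
  Nat.setGcd_dvd_of_mem ⟨d, rfl, h⟩

theorem ozoneExponent_dvd_of_pow_mem {i : Fin n} {N : ℕ} (h : x i ^ N ∈ Subring.center S) :
    ozoneExponent x i ∣ N := by
  have := ozoneExponent_dvd (x := x) (d := Pi.single i N) (by rwa [orderedMonomial_single]) i
  simpa using this

theorem dvd_ozoneExponent {i : Fin n} {a : ℕ}
    (h : ∀ d : Fin n → ℕ, orderedMonomial x d ∈ Subring.center S → a ∣ d i) :
    a ∣ ozoneExponent x i :=
  Nat.dvd_setGcd_iff.2 fun _ ⟨d, hd, hc⟩ => hd ▸ h d hc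

theorem ozoneExponent_pos (hp : IsMulAntisymm p) (hx : IsSkewGenerators p x)
    (hroot : ∀ i j, ∃ r : ℕ, 0 < r ∧ p i j ^ r = 1) (i : Fin n) : 0 < ozoneExponent x i := by
  obtain ⟨N, hN, h⟩ := hx.exists_pow_mem_center hp hroot
  exact Nat.pos_of_dvd_of_pos (ozoneExponent_dvd_of_pow_mem (h i)) hN

/-- If the order of `ζ` kills all `p j i`, that power of `x i` is central, so the order is a
multiple of the ozone exponent and a suitable power of `ζ` works. -/
theorem exists_orderOf_eq_ozoneExponent (hp : IsMulAntisymm p) (hx : IsSkewGenerators p x)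
    (hroot : ∀ i j, ∃ r : ℕ, 0 < r ∧ p i j ^ r = 1) (i : Fin n) :
    ∃ ζ : k, orderOf ζ = ozoneExponent x i := by
  obtain ⟨ζ, hζ, h⟩ := exists_orderOf_forall_pow_eq_one (fun j => p j i) Finset.univ
    fun j _ => hroot j i
  have hc := (hx.gen_pow_mem_center_iff hp i _).2 fun j => h j (Finset.mem_univ j)
  obtain ⟨c, hc⟩ := ozoneExponent_dvd_of_pow_mem hc
  have hc0 : c ≠ 0 := by
    rintro rfl
    omega
  refine ⟨ζ ^ c, ?_⟩
  rw [orderOf_pow_of_dvd hc0 (hc ▸ Dvd.intro_left _ rfl), hc,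
    Nat.mul_div_cancel _ (Nat.pos_of_ne_zero hc0)]

/-- The diagonal endomorphism scaling each generator. -/
theorem exists_diagonal (hx : IsSkewGenerators p x) (ξ : Fin n → k) :
    ∃ σ : S →ₐ[k] S, ∀ i, σ (x i) = ξ i • x i :=
  hx.exists_lift _ fun i j => by
    rw [smul_mul_smul_comm, smul_mul_smul_comm, hx.rel i j, smul_smul, smul_smul]
    congr 1
    ring

theorem diagonal_monomial {σ : S →ₐ[k] S} {ξ : Fin n → k} (hσ : ∀ i, σ (x i) = ξ i • x i)
    (d : Fin n → ℕ) : σ (orderedMonomial x d) = (∏ i, ξ i ^ d i) • orderedMonomial x d := by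
  rw [map_orderedMonomial]
  simp only [hσ]
  clear hσ σ
  induction n with
  | zero => simp [orderedMonomial]
  | succ n ih =>
    have := ih (x := Fin.tail x) (ξ := Fin.tail ξ) (Fin.tail d)
    rw [orderedMonomial_succ, orderedMonomial_succ, Fin.prod_univ_succ, mul_smul,
      ← mul_smul_comm, smul_pow, smul_mul_assoc]
    congr 2

/-- The reflection scaling one generator by a root of unity of order `ozoneExponent x i`. -/
theorem exists_reflection (hp : IsMulAntisymm p) (hx : IsSkewGenerators p x)
    (hroot : ∀ i j, ∃ r : ℕ, 0 < r ∧ p i j ^ r = 1) (i : Fin n) :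
    ∃ (σ : S →ₐ[k] S) (ζ : k), orderOf ζ = ozoneExponent x i ∧ σ (x i) = ζ • x i ∧
      (∀ z ∈ Subring.center S, σ z = z) ∧ ∀ s, x i ∣ σ s - s := by
  obtain ⟨ζ, hζ⟩ := hx.exists_orderOf_eq_ozoneExponent hp hroot i
  obtain ⟨σ, hσ⟩ := hx.exists_diagonal (Pi.mulSingle i ζ)
  have hmon : ∀ d, σ (orderedMonomial x d) = ζ ^ d i • orderedMonomial x d := by
    intro d
    rw [diagonal_monomial hσ, Finset.prod_eq_single i]
    · simp
    · intro j _ hj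
      simp [hj]
    · simp
  refine ⟨σ, ζ, hζ, by simp [hσ], fun z hz => ?_, fun s => ?_⟩
  · rw [hx.eq_sum hp z, Finsupp.sum, map_sum]
    refine Finset.sum_congr rfl fun d hd => ?_
    have hc := hx.monomial_mem_center_of_repr_ne_zero hp hz (Finsupp.mem_support_iff.1 hd)
    rw [map_smul, hmon, orderOf_dvd_iff_pow_eq_one.1 (hζ ▸ ozoneExponent_dvd hc i), one_smul]
  · rw [hx.eq_sum hp s, Finsupp.sum, map_sum, ← Finset.sum_sub_distrib]
    refine Finset.dvd_sum fun d _ => ?_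
    rw [map_smul, hmon]
    -- Monomials without `x i` are fixed; from any other monomial one `x i` can be pulled out on the
    -- left.
    by_cases hd : d i = 0
    · simp [hd]
    · have hsplit : Pi.single i 1 + (d - Pi.single i 1) = d := by
        ext j
        by_cases hj : j = i
        · subst hj
          simp
          omega
        · simp [hj]
      obtain ⟨c, -, hc⟩ := (hx.monomial_mul hp (Pi.single i 1) (d - Pi.single i 1)).symm
      rw [hsplit, orderedMonomial_single, pow_one] at hc
      refine ⟨((hx.basis hp).repr s d * (ζ ^ d i * c - c)) • orderedMonomial x
        (d - Pi.single i 1), ?_⟩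
      rw [hc, mul_smul_comm]
      module

end IsSkewGenerators

end OzoneSkew

/-! ### Comparison of two presentations -/

namespace OzoneSkew

namespace IsSkewGenerators

variable {k : Type*} [Field k] {S : Type*} [Ring S] [Algebra k S] {n : ℕ}
  {p : Matrix (Fin n) (Fin n) k} {x : Fin n → S}
  {m : ℕ} {q : Matrix (Fin m) (Fin m) k} {y : Fin m → S}

/-- The number of generators is at most that of any other presentation, by comparison of
tangent spaces at the origin. -/
theorem card_le (hx : IsSkewGenerators p x) (hy : IsSkewGenerators q y) : n ≤ m := by
  -- The generators go to infinitesimals, whose products vanish, so the relations hold trivially.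
  obtain ⟨h, hh⟩ := hx.exists_lift (A := TrivSqZeroExt k (Fin n → k))
    (fun i => TrivSqZeroExt.inr (Pi.single i 1)) fun i j => by simp
  let W : Submodule k (Fin n → k) := Submodule.span k (Set.range fun j => (h (y j)).snd)
  have hW : ∀ s, (h s).snd ∈ W := by
    intro s
    have hs : s ∈ Algebra.adjoin k (Set.range y) := by rw [hy.adjoin_eq_top]; trivial
    induction hs using Algebra.adjoin_induction with
    | mem s hs =>
      obtain ⟨j, rfl⟩ := hs
      exact Submodule.subset_span ⟨j, rfl⟩
    | algebraMap r => simp [TrivSqZeroExt.algebraMap_eq_inl]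
    | add a b _ _ ha hb =>
      rw [map_add, TrivSqZeroExt.snd_add]
      exact W.add_mem ha hb
    | mul a b _ _ ha hb =>
      -- By the Leibniz rule products stay in `W`, even when the images of the `y j` have nonzero
      -- constant terms.
      rw [map_mul, TrivSqZeroExt.snd_mul, op_smul_eq_smul]
      exact W.add_mem (W.smul_mem _ hb) (W.smul_mem _ ha)
  have htop : W = ⊤ := by
    rw [eq_top_iff, ← (Pi.basisFun k (Fin n)).span_eq]
    refine Submodule.span_le.2 ?_
    rintro _ ⟨i, rfl⟩
    simpa [hh] using hW (x i)
  have := finrank_range_le_card (R := k) fun j => (h (y j)).snd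
  rw [Set.finrank] at this
  change Module.finrank k W ≤ _ at this
  rw [htop, finrank_top] at this
  simpa using this

theorem isUnit_of_scalarEq_one {s : S} (h : ScalarEq k s 1) : IsUnit s := by
  obtain ⟨c, hc, rfl⟩ := h
  rw [← Algebra.algebraMap_eq_smul_one]
  exact (IsUnit.mk0 c hc).map _

theorem not_isUnit_gen (hp : IsMulAntisymm p) (hx : IsSkewGenerators p x) (i : Fin n) :
    ¬ IsUnit (x i) := by
  rintro h
  obtain ⟨t, ht⟩ := h.exists_right_inv
  have h1 : ScalarEq k (x i * t) (orderedMonomial x 0) := by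
    rw [ht, orderedMonomial_zero]
    exact ScalarEq.refl 1
  obtain ⟨α, β, hα, -, hs⟩ := hx.scalarEq_of_mul hp h1
  have h2 : ScalarEq k (x i) (orderedMonomial x (Pi.single i 1)) := by
    rw [orderedMonomial_single, pow_one]
    exact ScalarEq.refl _
  have h3 := hx.eq_of_scalarEq hp (h2.symm.trans hα)
  have h4 := congrFun hs i
  simp [← h3] at h4

theorem eq_of_gen_scalarEq (hp : IsMulAntisymm p) (hx : IsSkewGenerators p x) {i j : Fin n}
    (h : ScalarEq k (x i) (x j)) : i = j := by
  have := hx.eq_of_scalarEq hp (d := Pi.single i 1) (e := Pi.single j 1)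
    (by simpa [orderedMonomial_single] using h)
  by_contra hij
  have h1 := congrFun this i
  simp [hij] at h1

/-- A nonunit dividing a generator is that generator up to a scalar. -/
theorem scalarEq_gen_of_dvd (hp : IsMulAntisymm p) (hx : IsSkewGenerators p x) {z : S}
    (hz : ¬ IsUnit z) {i : Fin n} (h : z ∣ x i) : ScalarEq k z (x i) := by
  obtain ⟨a, ha⟩ := h
  have h1 : ScalarEq k (z * a) (orderedMonomial x (Pi.single i 1)) := by
    rw [← ha, orderedMonomial_single, pow_one]
    exact ScalarEq.refl _
  obtain ⟨α, β, hα, -, hs⟩ := hx.scalarEq_of_mul hp h1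
  by_cases hi : α i = 0
  · have h0 : α = 0 := by
      ext j
      by_cases hj : j = i
      · rw [hj, hi]; rfl
      · have := congrFun hs j
        simp [hj] at this
        exact this.1
    rw [h0, orderedMonomial_zero] at hα
    exact absurd (isUnit_of_scalarEq_one hα) hz
  · have h0 : α = Pi.single i 1 := by
      ext j
      have := congrFun hs j
      by_cases hj : j = i
      · subst hj
        simp at this ⊢
        omega
      · simp [hj] at this ⊢
        exact this.1
    rwa [h0, orderedMonomial_single, pow_one] at hα

/-- A generator with nontrivial reflections is, up to a scalar, a generator of every other
presentation. -/
theorem exists_scalarEq_gen (hp : IsMulAntisymm p) (hx : IsSkewGenerators p x)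
    (hroot : ∀ i j, ∃ r : ℕ, 0 < r ∧ p i j ^ r = 1)
    (hq : IsMulAntisymm q) (hy : IsSkewGenerators q y) {i : Fin n} (hi : 1 < ozoneExponent x i) :
    ∃ j, ScalarEq k (x i) (y j) ∧ ozoneExponent x i ∣ ozoneExponent y j := by
  obtain ⟨σ, ζ, hζ, hσi, hσc, hσd⟩ := hx.exists_reflection hp hroot i
  obtain ⟨N, hN, hyN⟩ := hy.exists_pow_mem_center hq (hx.isRoot_of_isRoot hp hroot hq hy)
  have hdiag : ∀ j, ScalarEq k (σ (y j)) (y j) := fun j =>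
    hy.scalarEq_gen_of_pow_eq hq hN (by rw [← map_pow, hσc _ (hyN j)])
  choose ξ _ hξ using hdiag
  have hζ1 : ζ ≠ 1 := by
    rintro rfl
    simp at hζ
    omega
  -- Otherwise `σ` would be the identity, although it scales `x i` by `ζ ≠ 1`.
  obtain ⟨j, hj⟩ : ∃ j, ξ j ≠ 1 := by
    by_contra! hall
    have hid : σ = AlgHom.id k S := by
      refine AlgHom.ext_of_adjoin_eq_top hy.adjoin_eq_top ?_
      rintro _ ⟨j, rfl⟩
      simp [hξ, hall]
    rw [hid, AlgHom.id_apply] at hσi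
    have hne : x i ≠ 0 := by
      have := hx.monomial_ne_zero hp (Pi.single i 1)
      rwa [orderedMonomial_single, pow_one] at this
    exact hζ1 (smul_left_injective k hne (by simpa using hσi.symm))
  -- Here `σ (y l) - y l` is a nonzero scalar multiple of `y l`.
  have hdvd : ∀ l, ξ l ≠ 1 → x i ∣ y l := by
    intro l hl
    obtain ⟨a, ha⟩ := hσd (y l)
    refine ⟨(ξ l - 1)⁻¹ • a, ?_⟩
    rw [mul_smul_comm, ← ha, hξ, show ξ l • y l - y l = (ξ l - 1) • y l by
      rw [sub_smul, one_smul], smul_smul, inv_mul_cancel₀ (sub_ne_zero.2 hl), one_smul]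
  have hxy := hy.scalarEq_gen_of_dvd hq (hx.not_isUnit_gen hp i) (hdvd j hj)
  have hσy : σ (y j) = ζ • y j := by
    obtain ⟨c, -, hc⟩ := hxy.symm
    rw [hc, map_smul, hσi, smul_comm]
  -- Only `y j` is moved, and its scalar is `ζ`; since `σ` fixes a central monomial of exponent `d`,
  -- `ζ ^ d j = 1`.
  refine ⟨j, hxy, dvd_ozoneExponent fun d hd => ?_⟩
  have h1 := diagonal_monomial hξ d
  rw [hσc _ hd] at h1
  have h2 : ∏ l, ξ l ^ d l = 1 :=
    smul_left_injective k (hy.monomial_ne_zero hq d) (by simpa using h1.symm)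
  have hother : ∀ l, l ≠ j → ξ l = 1 := by
    intro l hl
    by_contra hl1
    have hxl := hy.scalarEq_gen_of_dvd hq (hx.not_isUnit_gen hp i) (hdvd l hl1)
    exact hl (hy.eq_of_gen_scalarEq hq (hxl.symm.trans hxy))
  rw [Finset.prod_eq_single j (fun l _ hl => by rw [hother l hl, one_pow]) (by simp)] at h2
  have hξj : ξ j = ζ := by
    have hne : y j ≠ 0 := by
      have := hy.monomial_ne_zero hq (Pi.single j 1)
      rwa [orderedMonomial_single, pow_one] at this
    exact smul_left_injective k hne ((hξ j).symm.trans hσy)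
  rw [← hζ]
  exact orderOf_dvd_iff_pow_eq_one.2 (hξj ▸ h2)

/-- Passing from `x` to `y` and back returns to the same generator, so the two exponents divide each
other. -/
theorem exists_scalarEq_gen_and_eq (hp : IsMulAntisymm p) (hx : IsSkewGenerators p x)
    (hroot : ∀ i j, ∃ r : ℕ, 0 < r ∧ p i j ^ r = 1)
    (hq : IsMulAntisymm q) (hy : IsSkewGenerators q y) {i : Fin n} (hi : 1 < ozoneExponent x i) :
    ∃ j, ScalarEq k (x i) (y j) ∧ ozoneExponent x i = ozoneExponent y j := by
  have hroot' := hx.isRoot_of_isRoot hp hroot hq hy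
  obtain ⟨j, hj, hij⟩ := hx.exists_scalarEq_gen hp hroot hq hy hi
  have hj1 : 1 < ozoneExponent y j :=
    hi.trans_le (Nat.le_of_dvd (hy.ozoneExponent_pos hq hroot' j) hij)
  obtain ⟨i', hi', hji⟩ := hy.exists_scalarEq_gen hq hroot' hp hx hj1
  obtain rfl := hx.eq_of_gen_scalarEq hp (hj.trans hi')
  exact ⟨j, hj, Nat.dvd_antisymm hij hji⟩

/-- Monomials in matching generators agree up to a scalar. -/
theorem orderedMonomial_scalarEq (hq : IsMulAntisymm q) (hy : IsSkewGenerators q y)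
    (τ : Fin n ≃ Fin m) (d : Fin n → ℕ) (e : Fin m → ℕ) (he : ∀ i, e (τ i) = d i)
    (h : ∀ i, d i ≠ 0 → ScalarEq k (x i) (y (τ i))) :
    ScalarEq k (orderedMonomial x d) (orderedMonomial y e) := by
  have hl : ∀ l : List (Fin n), ScalarEq k (l.map fun i => x i ^ d i).prod
      (orderedMonomial y (l.map fun i => (Pi.single (τ i) (d i) : Fin m → ℕ)).sum) := by
    intro l
    induction l with
    | nil => simpa [orderedMonomial_zero] using ScalarEq.refl (k := k) (1 : S)
    | cons i l ih =>
      simp only [List.map_cons, List.prod_cons, List.sum_cons]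
      refine ScalarEq.trans (ScalarEq.mul ?_ ih) (hy.monomial_mul hq _ _)
      rw [orderedMonomial_single]
      by_cases hd : d i = 0
      · simpa [hd] using ScalarEq.refl (k := k) (1 : S)
      · exact (h i hd).pow _
  have hsum : ((List.finRange n).map fun i => (Pi.single (τ i) (d i) : Fin m → ℕ)).sum = e := by
    rw [← List.ofFn_eq_map, List.sum_ofFn]
    simp only [← he]
    rw [Equiv.sum_comp τ fun j => (Pi.single j (e j) : Fin m → ℕ)]
    exact Finset.univ_sum_single e
  have := hl (List.finRange n)
  rwa [hsum, ← List.ofFn_eq_map] at this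

/-- Two presentations match up to a permutation and scalars on the generators with nontrivial
ozone exponent. -/
theorem exists_equiv (hp : IsMulAntisymm p) (hx : IsSkewGenerators p x)
    (hroot : ∀ i j, ∃ r : ℕ, 0 < r ∧ p i j ^ r = 1)
    (hq : IsMulAntisymm q) (hy : IsSkewGenerators q y) :
    ∃ τ : Fin n ≃ Fin m, (∀ i, ozoneExponent y (τ i) = ozoneExponent x i) ∧
      ∀ i, 1 < ozoneExponent x i → ScalarEq k (x i) (y (τ i)) := by
  have hroot' := hx.isRoot_of_isRoot hp hroot hq hy
  obtain rfl : n = m := le_antisymm (hx.card_le hy) (hy.card_le hx)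
  choose f hf hfe using fun i : {i // 1 < ozoneExponent x i} =>
    hx.exists_scalarEq_gen_and_eq hp hroot hq hy i.2
  let g : {i // 1 < ozoneExponent x i} → {j // 1 < ozoneExponent y j} :=
    fun i => ⟨f i, hfe i ▸ i.2⟩
  have hg : Function.Bijective g := by
    constructor
    · intro i i' h
      have h1 : f i = f i' := congrArg Subtype.val h
      have h2 := (hf i').symm
      rw [← h1] at h2
      exact Subtype.ext (hx.eq_of_gen_scalarEq hp ((hf i).trans h2))
    · rintro ⟨j, hj⟩
      obtain ⟨i, hi, he⟩ := hy.exists_scalarEq_gen_and_eq hq hroot' hp hx hj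
      exact ⟨⟨i, he ▸ hj⟩, Subtype.ext (hy.eq_of_gen_scalarEq hq (hi.trans (hf ⟨i, he ▸ hj⟩)).symm)⟩
  let e := Equiv.ofBijective g hg
  have happ : ∀ i (hi : 1 < ozoneExponent x i), e.extendSubtype i = f ⟨i, hi⟩ := fun i hi =>
    e.extendSubtype_apply_of_mem i hi
  refine ⟨e.extendSubtype, fun i => ?_, fun i hi => ?_⟩
  · by_cases hi : 1 < ozoneExponent x i
    · rw [happ i hi, ← hfe]
    -- Outside the matched indices both exponents are positive and not above 1.
    · have h1 := e.extendSubtype_not_mem i hi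
      have h2 := hx.ozoneExponent_pos hp hroot i
      have h3 := hy.ozoneExponent_pos hq hroot' (e.extendSubtype i)
      omega
  · rw [happ i hi]
    exact hf ⟨i, hi⟩

end IsSkewGenerators

/-! ### Transport along the isomorphism and conclusion -/

theorem ozoneExponent_map {S T : Type*} [Ring S] [Ring T] (φ : S ≃+* T) {n : ℕ} (x : Fin n → S)
    (i : Fin n) : ozoneExponent (fun i => φ (x i)) i = ozoneExponent x i := by
  have h : ∀ s, φ s ∈ Subring.center T ↔ s ∈ Subring.center S := by
    intro s
    simp only [Subring.mem_center_iff, φ.surjective.forall, ← map_mul, φ.injective.eq_iff]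
  simp only [ozoneExponent, ← map_orderedMonomial, h]

end OzoneSkew

theorem proposition1p8 {k : Type*} [Field k] [CharZero k]
    {S : Type*} [Ring S] [Algebra k S] {T : Type*} [Ring T] [Algebra k T]
    {n m : ℕ} (p : Matrix (Fin n) (Fin n) k) (q : Matrix (Fin m) (Fin m) k)
    (hp : OzoneSkew.IsMulAntisymm p) (hq : OzoneSkew.IsMulAntisymm q)
    (hroot : ∀ i j, ∃ r : ℕ, 0 < r ∧ p i j ^ r = 1)
    (hnoncomm : ∃ i j, p i j ≠ 1)
    (x : Fin n → S) (hx : OzoneSkew.IsSkewGenerators p x)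
    (y : Fin m → T) (hy : OzoneSkew.IsSkewGenerators q y)
    (φ : S ≃ₐ[k] T) :
    (∃ c : k, c ≠ 0 ∧ φ (OzoneSkew.ozoneJacobian x) = c • OzoneSkew.ozoneJacobian y) ∧
    (∃ c : k, c ≠ 0 ∧ φ (OzoneSkew.ozoneArrangement x) = c • OzoneSkew.ozoneArrangement y) ∧
    (∃ c : k, c ≠ 0 ∧ φ (OzoneSkew.ozoneDiscriminant x) = c • OzoneSkew.ozoneDiscriminant y) ∧
    OzoneSkew.ozoneExponents x = OzoneSkew.ozoneExponents y := by
  obtain ⟨τ, hτ, hxy⟩ := (hx.map φ).exists_equiv hp hroot hq hy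
  have hmap : ∀ i, OzoneSkew.ozoneExponent (fun i => φ (x i)) i = OzoneSkew.ozoneExponent x i :=
    OzoneSkew.ozoneExponent_map φ.toRingEquiv x
  simp only [hmap] at hτ hxy
  -- All three elements are monomials whose exponents are one function `f` of the ozone exponents.
  -- Vanishing at 0 and 1 confines the monomial to generators that match up to scalars.
  have key : ∀ f : ℕ → ℕ, f 1 = 0 → f 0 = 0 →
      OzoneSkew.ScalarEq k (φ (OzoneSkew.orderedMonomial x fun i => f (OzoneSkew.ozoneExponent x i)))
        (OzoneSkew.orderedMonomial y fun j => f (OzoneSkew.ozoneExponent y j)) := by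
    intro f h1 h0
    rw [OzoneSkew.map_orderedMonomial]
    refine hy.orderedMonomial_scalarEq hq τ _ _ (fun i => by rw [hτ]) fun i hi => hxy i ?_
    by_contra hle
    rcases (by omega : OzoneSkew.ozoneExponent x i = 0 ∨ OzoneSkew.ozoneExponent x i = 1) with
      h | h <;> simp [h, h1, h0] at hi
  refine ⟨key (fun a => a - 1) rfl rfl, key (fun a => if 1 < a then 1 else 0) rfl rfl,
    key (fun a => if 1 < a then a else 0) rfl rfl, ?_⟩
  rw [OzoneSkew.ozoneExponents, OzoneSkew.ozoneExponents,
    ← Multiset.map_univ_val_equiv τ, Multiset.map_map]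
  exact Multiset.map_congr rfl fun i _ => (hτ i).symm
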